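/- **Setting.** Let $d\in\{2,3\}$ and let $\Omega\subset\mathbb R^d$ be a polyhedral domain (open, connected, bounded, $\Omega=\operatorname{int}\overline\Omega$) whose boundary is the disjoint union of (measurable sets) $\partial_1\Omega$ and $\partial_2\Omega$; let $\vec{\rm n}$ be the outer unit normal. Let $\rho_\pm\ge 0$, $\mu_\pm>0$, $\gamma>0$, $\beta\ge 0$, and let $\vec f_1,\vec f_2$ be $\mathbb R^d$-valued functions of $(x,t)\in\overline\Omega\times[0,T]$ (only their point values are used). Let $0=t_0<t_1<\dots<t_M=T$ be an arbitrary partition and $\tau_m=t_{m+1}-t_m$. Write $(\cdot,\cdot)$ for the $L^2(\Omega)$ inner product, $\mathcal H^{d-1}$ for the Hausdorff measure (normalised to agree with Lebesgue measure on hyperplanes), $D(\vec u)=\frac12(\nabla\vec u+(\nabla\vec u)^T)$, and $\langle \vec u,\vec v\rangle_{\partial_2\Omega,\vec{\rm t}}=\sum_{i=1}^{d-1}\int_{\partial_2\Omega}(\vec u\cdot\vec{\rm t}_i)(\vec v\cdot\vec{\rm t}_i)\,d\mathcal H^{d-1}$, where $\{\vec{\rm t}_i\}$ is an orthonormal basis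 of $\{\vec{\rm n}\}^\perp$. For $m=0,\dots,M-1$ let $\mathcal T^m$ be a conforming partition of $\Omega$ into finitely many disjoint open simplices; the meshes at different times are unrelated. $I^m_0$ is the elementwise mean value projection onto piecewise constants on $\mathcal T^m$, and $I^m_2$ is nodal interpolation (vertices and edge midpoints) onto continuous piecewise quadratics on $\mathcal T^m$. Let $\mathbb U^m$ be a linear space of continuous vector fields on $\overline\Omega$, piecewise polynomial on $\mathcal T^m$ with bounded degree, which vanish a.e. on $\partial_1\Omega$ and have zero normal component a.e. on $\partial_2\Omega$; let $\mathbb P^m$ be a linear subspace of $L^2(\Omega)$ and $\widehat{\mathbb P}^m=\{\varphi\in\mathbb P^m:\int_\Omega\varphi=0\}$. Let $\Gamma^m$, $m=0,\dots,M-1$, be a closed polyhedral hypersurface without self-intersections: $\Gamma^m=\bigcup_j\overline{\sigma^m_j}$ with finitely many disjoint nondegenerate open $(d-1)$-simplices $\sigma_j^m$ without hanging vertices, and $\Gamma^m=\partial\Omega^m_-=\overline{\Omega^m_-}\cap\overline{\Omega^m_+}$, where $\Omega^m_-$ (interior) is bounded and open and $\Omega^m_+=\mathbb R^d\setminus\overline{\Omega^m_-}$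 (exterior). Let $\vec\nu^m$ be the piecewise constant unit normal pointing into $\Omega^m_+$. $W(\Gamma^m)$ and $\underline V(\Gamma^m)$ are the continuous functions on $\Gamma^m$, with values in $\mathbb R$ and $\mathbb R^d$ respectively, that are affine on each simplex. $\langle\cdot,\cdot\rangle_{\Gamma^m}$ is the $L^2(\Gamma^m)$ inner product and $\langle v,w\rangle^h_{\Gamma^m}=\frac1d\sum_j\mathcal H^{d-1}(\sigma^m_j)\sum_{k=1}^d (v\cdot w)|_{\sigma^m_j}(\vec q^m_{j_k})$ is its mass lumped version, where $\vec q^m_{j_k}$ are the vertices of $\sigma^m_j$; $\nabla_s$ is the surface gradient. The density $\rho^m$ and viscosity $\mu^m$ are piecewise constant on $\mathcal T^m$, with values $\rho_\pm,\mu_\pm$ on the elements contained in $\Omega^m_\pm$. On the other elements $o$ one uses either the arithmetic means $\frac12(\rho_-+\rho_+)$, $\frac12(\mu_-+\mu_+)$ throughout, or throughout the averages with weight $\mathcal L^d(o\cap\Omega^m_-)/\mathcal L^d(o)$ for the phase $-$ and the complementary weight for the phase $+$. Set $\rho^{-1}:=\rho^0$ and $\vec f_i^{m+1}=I^m_2\vec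 f_i(\cdot,t_{m+1})$. **Scheme.** Given $\Gamma^0$ and a $\vec U^0\in\mathbb U^0$ which is piecewise quadratic on $\mathcal T^0$, let $\vec U^{m+1}\in\mathbb U^m$, $P^{m+1}\in\widehat{\mathbb P}^m$, $\vec X^{m+1}\in\underline V(\Gamma^m)$, $\kappa^{m+1}\in W(\Gamma^m)$, $m=0,\dots,M-1$, satisfy $$\begin{aligned} &\tfrac12\Big(\tfrac{\rho^m\vec U^{m+1}-(I^m_0\rho^{m-1})I^m_2\vec U^m}{\tau_m}+(I^m_0\rho^{m-1})\tfrac{\vec U^{m+1}-I^m_2\vec U^m}{\tau_m},\vec\xi\Big)+2(\mu^mD(\vec U^{m+1}),D(\vec\xi))\\ &\quad+\tfrac12\big(\rho^m,[(I^m_2\vec U^m\cdot\nabla)\vec U^{m+1}]\cdot\vec\xi-[(I^m_2\vec U^m\cdot\nabla)\vec\xi]\cdot\vec U^{m+1}\big)-(P^{m+1},\nabla\cdot\vec\xi)\\ &\quad+\beta\langle\vec U^{m+1},\vec\xi\rangle_{\partial_2\Omega,\vec{\rm t}}-\gamma\langle\kappa^{m+1}\vec\nu^m,\vec\xi\rangle_{\Gamma^m}=(\rho^m\vec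 f^{m+1}_1+\vec f^{m+1}_2,\vec\xi)\quad\forall\,\vec\xi\in\mathbb U^m,\\ &(\nabla\cdot\vec U^{m+1},\varphi)=0\quad\forall\,\varphi\in\widehat{\mathbb P}^m,\\ &\big\langle\tfrac{\vec X^{m+1}-\vec{\rm id}}{\tau_m},\chi\vec\nu^m\big\rangle^h_{\Gamma^m}-\langle\vec U^{m+1},\chi\vec\nu^m\rangle_{\Gamma^m}=0\quad\forall\,\chi\in W(\Gamma^m),\\ &\langle\kappa^{m+1}\vec\nu^m,\vec\eta\rangle^h_{\Gamma^m}+\langle\nabla_s\vec X^{m+1},\nabla_s\vec\eta\rangle_{\Gamma^m}=0\quad\forall\,\vec\eta\in\underline V(\Gamma^m), \end{aligned}$$ with $\Gamma^{m+1}=\vec X^{m+1}(\Gamma^m)$. **Assumption $(\mathcal A)$.** For $m=0,\dots,M-1$: $\mathcal H^{d-1}(\sigma^m_j)>0$ for all $j$, $\Gamma^m\subset\overline\Omega$, and the vertex normals $\vec\omega^m_k=\frac{1}{\mathcal H^{d-1}(\Lambda^m_k)}\sum_{j:\,\vec q^m_k\in\overline{\sigma^m_j}}\mathcal H^{d-1}(\sigma^m_j)\,\vec\nu^m|_{\sigma^m_j}$,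 with $\Lambda^m_k$ the union of the closed simplices containing the vertex $\vec q^m_k$, span $\mathbb R^d$. **Theorem 4.2.** Let $(\mathcal A)$ hold and assume that $$((I^m_0\rho^{m-1})\,I^m_2\vec U^m,I^m_2\vec U^m)\le(\rho^{m-1}\vec U^m,\vec U^m)\qquad\text{for } m=1,\dots,M-1.$$ With $\mathcal E(\xi,\vec V,\mathcal M)=\frac12(\xi\vec V,\vec V)+\gamma\,\mathcal H^{d-1}(\mathcal M)$, every solution of the scheme satisfies, for $m=0,\dots,M-1$ and without any restriction on the time steps, $$\begin{aligned} &\mathcal E(\rho^m,\vec U^{m+1},\Gamma^{m+1})+\tfrac12\sum_{k=0}^m\Big[\big((I^k_0\rho^{k-1})(\vec U^{k+1}-I^k_2\vec U^k),\vec U^{k+1}-I^k_2\vec U^k\big)\\ &\qquad+4\tau_k(\mu^kD(\vec U^{k+1}),D(\vec U^{k+1}))+2\beta\tau_k\langle\vec U^{k+1},\vec U^{k+1}\rangle_{\partial_2\Omega,\vec{\rm t}}\Big]\\ &\le\mathcal E(\rho^{-1},\vec U^0,\Gamma^0)+\sum_{k=0}^m\tau_k(\rho^k\vec f^{k+1}_1+\vec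 f^{k+1}_2,\vec U^{k+1}). \end{aligned}$$ -/

import Mathlib

open MeasureTheory Set Filter Topology

noncomputable section

namespace TwoPhaseFEM

/-- The ambient Euclidean space of dimension `d = n + 1`. Hypersurfaces have dimension
`n = d - 1`, and their area is measured by the Euclidean Hausdorff measure `μHE[n]`
(normalised so as to agree with `n`-dimensional Lebesgue measure). -/
abbrev Pt (n : ℕ) : Type := EuclideanSpace ℝ (Fin (n + 1))

/-! ### Bulk triangulations and finite element functions -/

/-- A conforming partition of `Ω` into finitely many disjoint open simplices. -/
structure BulkMesh (n : ℕ) (Ω : Set (Pt n)) where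
  J : ℕ
  elem : Fin J → Affine.Simplex ℝ (Pt n) (n + 1)
  disjoint : Pairwise fun i j => Disjoint (elem i).interior (elem j).interior
  conforming : ∀ i j, (elem i).closedInterior ∩ (elem j).closedInterior =
    convexHull ℝ (range (elem i).points ∩ range (elem j).points)
  interior_subset : ∀ j, (elem j).interior ⊆ Ω
  closure_eq : closure Ω = ⋃ j, (elem j).closedInterior

variable {n : ℕ} {Ω : Set (Pt n)}

/-- The open element `o_j` of the mesh. -/
def BulkMesh.cell (𝒯 : BulkMesh n Ω) (j : Fin 𝒯.J) : Set (Pt n) := (𝒯.elem j).interior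

/-- Membership in `[S_k]^d`: continuous on the closure of `Ω`, and on every element each
component is a polynomial of degree at most `k`. Such functions belong to `H¹(Ω)`, and their
weak gradient is almost everywhere the classical gradient on the open elements. -/
def BulkMesh.IsPiecewisePoly (𝒯 : BulkMesh n Ω) (k : ℕ) (φ : Pt n → Pt n) : Prop :=
  ContinuousOn φ (closure Ω) ∧
    ∀ j, ∃ p : Fin (n + 1) → MvPolynomial (Fin (n + 1)) ℝ,
      (∀ i, (p i).totalDegree ≤ k) ∧
        ∀ x ∈ 𝒯.cell j, ∀ i, φ x i = MvPolynomial.eval (fun l => x l) (p i)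

/-- The piecewise constant function with value `c j` on the open element `o_j`
(and zero on the skeleton of the mesh, which is a null set). -/
def BulkMesh.pwConst (𝒯 : BulkMesh n Ω) (c : Fin 𝒯.J → ℝ) (x : Pt n) : ℝ :=
  ∑ j, (𝒯.cell j).indicator (fun _ => c j) x

/-- The projection `I_0` onto piecewise constants by elementwise averages. -/
def BulkMesh.I0 (𝒯 : BulkMesh n Ω) (η : Pt n → ℝ) : Pt n → ℝ :=
  𝒯.pwConst fun j => (volume.real (𝒯.cell j))⁻¹ * ∫ x in 𝒯.cell j, η x

/-- The vertices of a full-dimensional simplex as an affine basis; its coordinate functions are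
the barycentric coordinates. -/
def simplexBasis (s : Affine.Simplex ℝ (Pt n) (n + 1)) : AffineBasis (Fin (n + 2)) ℝ (Pt n) :=
  ⟨s.points, s.independent,
    (s.independent.affineSpan_eq_top_iff_card_eq_finrank_add_one).2 (by simp)⟩

/-- The quadratic Lagrange interpolant of `η` on one simplex; the nodes are the vertices and the
midpoints of the edges. -/
def quadInterp (s : Affine.Simplex ℝ (Pt n) (n + 1)) (η : Pt n → Pt n) (x : Pt n) : Pt n :=
  ∑ a, ((simplexBasis s).coord a x * (2 * (simplexBasis s).coord a x - 1)) • η (s.points a) +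
    ∑ a, ∑ b ∈ Finset.Ioi a,
      (4 * (simplexBasis s).coord a x * (simplexBasis s).coord b x) •
        η (midpoint ℝ (s.points a) (s.points b))

open Classical in
/-- The nodal interpolation operator `I_2` onto continuous piecewise quadratics. By conformity of
the mesh the value does not depend on the choice of the closed element containing `x`. -/
def BulkMesh.I2 (𝒯 : BulkMesh n Ω) (η : Pt n → Pt n) (x : Pt n) : Pt n :=
  if h : ∃ j, x ∈ (𝒯.elem j).closedInterior then quadInterp (𝒯.elem h.choose) η x else 0

/-! ### Differential operators in the bulk -/

/-- The matrix `∇u`, with entries `∂_j u_i`. -/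
def gradMat (u : Pt n → Pt n) (x : Pt n) : Matrix (Fin (n + 1)) (Fin (n + 1)) ℝ :=
  Matrix.of fun i j => fderiv ℝ u x (EuclideanSpace.single j 1) i

/-- The rate of deformation tensor `D(u) = ½ (∇u + (∇u)ᵀ)`. -/
def symGrad (u : Pt n → Pt n) (x : Pt n) : Matrix (Fin (n + 1)) (Fin (n + 1)) ℝ :=
  (1 / 2 : ℝ) • (gradMat u x + (gradMat u x).transpose)

/-- The divergence of `u`. -/
def divergence (u : Pt n → Pt n) (x : Pt n) : ℝ := (gradMat u x).trace

/-- `(v · ∇) w`. -/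
def convect (v w : Pt n → Pt n) (x : Pt n) : Pt n := fderiv ℝ w x (v x)

/-- The weighted product `(a u, v) = ∫_Ω a u · v`. -/
def wInner (Ω : Set (Pt n)) (a : Pt n → ℝ) (u v : Pt n → Pt n) : ℝ :=
  ∫ x in Ω, a x * inner ℝ (u x) (v x)

/-- `(a D(u), D(v)) = ∫_Ω a D(u) : D(v)`. -/
def viscInner (Ω : Set (Pt n)) (a : Pt n → ℝ) (u v : Pt n → Pt n) : ℝ :=
  ∫ x in Ω, a x * ∑ i, ∑ j, symGrad u x i j * symGrad v x i j

/-! ### The boundary of the domain -/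

/-- `ν` is the outer unit normal to `Ω` at `x`, where the boundary of `Ω` is flat near `x`. -/
def IsOuterNormal (Ω : Set (Pt n)) (x ν : Pt n) : Prop :=
  ‖ν‖ = 1 ∧ ∃ r > 0, ∀ y ∈ Metric.ball x r, y ∈ Ω ↔ inner ℝ (y - x) ν < 0

open Classical in
/-- The outer unit normal on the boundary of a polyhedral domain, defined except on the lower
dimensional faces, where it is set to zero. -/
def outerNormal (Ω : Set (Pt n)) (x : Pt n) : Pt n :=
  if h : ∃ ν, IsOuterNormal Ω x ν then h.choose else 0

/-- `⟨u, v⟩_{B, t} = ∑_i ∫_B (u · t_i) (v · t_i) dH^{d-1}`, with `t_i` an orthonormal basis of the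
orthogonal complement of the outer normal. -/
def tangInner (Ω B : Set (Pt n)) (u v : Pt n → Pt n) : ℝ :=
  ∫ x in B, ∑ i, inner ℝ (u x) (stdOrthonormalBasis ℝ (ℝ ∙ outerNormal Ω x)ᗮ i : Pt n) *
    inner ℝ (v x) (stdOrthonormalBasis ℝ (ℝ ∙ outerNormal Ω x)ᗮ i : Pt n) ∂μHE[n]

/-! ### Polyhedral interfaces -/

/-- The generalised cross product `(q₁ - q₀) ∧ ⋯ ∧ (q_n - q₀)` of the edges of an
`n`-dimensional simplex in dimension `n + 1`. -/
def edgeWedge (s : Affine.Simplex ℝ (Pt n) n) : Pt n :=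
  WithLp.toLp 2 fun i => Matrix.det (Matrix.of (Matrix.vecCons (Pi.single i (1 : ℝ))
    fun (k : Fin n) (l : Fin (n + 1)) => s.points k.succ l - s.points 0 l))

/-- The unit normal of an `n`-dimensional simplex determined by the order of its vertices. -/
def facetNormal (s : Affine.Simplex ℝ (Pt n) n) : Pt n := ‖edgeWedge s‖⁻¹ • edgeWedge s

/-- A closed polyhedral hypersurface without self intersections: a conforming family of disjoint
nondegenerate `n`-simplices whose union is the common boundary of a bounded open set `inside` and
of the exterior of that set. The vertices are ordered such that the unit normals
point into the exterior. -/
structure Interface (n : ℕ) where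
  J : ℕ
  facet : Fin J → Affine.Simplex ℝ (Pt n) n
  disjoint : Pairwise fun i j => Disjoint (facet i).interior (facet j).interior
  conforming : ∀ i j, (facet i).closedInterior ∩ (facet j).closedInterior =
    convexHull ℝ (range (facet i).points ∩ range (facet j).points)
  inside : Set (Pt n)
  isOpen_inside : IsOpen inside
  isBounded_inside : Bornology.IsBounded inside
  frontier_inside : frontier inside = ⋃ j, (facet j).closedInterior
  closure_inter_closure :
    closure inside ∩ closure (closure inside)ᶜ = ⋃ j, (facet j).closedInterior
  normal_outward : ∀ j, ∀ x ∈ (facet j).interior,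
    ∀ᶠ ε : ℝ in 𝓝[>] 0, x + ε • facetNormal (facet j) ∈ (closure inside)ᶜ

/-- The surface as a set. -/
def Interface.carrier (Γ : Interface n) : Set (Pt n) := ⋃ j, (Γ.facet j).closedInterior

/-- The exterior region. -/
def Interface.outside (Γ : Interface n) : Set (Pt n) := (closure Γ.inside)ᶜ

/-- The piecewise constant unit normal on the `j`-th simplex. -/
def Interface.normal (Γ : Interface n) (j : Fin Γ.J) : Pt n := facetNormal (Γ.facet j)

/-- The area of the `j`-th open simplex. -/
def Interface.area (Γ : Interface n) (j : Fin Γ.J) : ℝ := (μHE[n]).real (Γ.facet j).interior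

/-- Continuous piecewise linear functions on the surface, with values in `ℝ` (the space `W(Γ)`) or
in `ℝ^d` (the space `V(Γ)`). Only the values on the surface matter. -/
def Interface.IsPL {F : Type*} [NormedAddCommGroup F] [NormedSpace ℝ F] (Γ : Interface n)
    (χ : Pt n → F) : Prop :=
  ContinuousOn χ Γ.carrier ∧
    ∀ j, ∃ a : Pt n →ᵃ[ℝ] F, EqOn χ a (Γ.facet j).closedInterior

/-- The integral over the surface of a function given by `f j` on the `j`-th simplex. -/
def Interface.surfInt (Γ : Interface n) (f : Fin Γ.J → Pt n → ℝ) : ℝ :=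
  ∑ j, ∫ x in (Γ.facet j).interior, f j x ∂μHE[n]

/-- The mass lumped integral of a piecewise continuous function given by `f j` on the `j`-th
closed simplex, so that `f j` at a vertex is the limit from within that simplex. -/
def Interface.lumpInt (Γ : Interface n) (f : Fin Γ.J → Pt n → ℝ) : ℝ :=
  (1 / ((n : ℝ) + 1)) * ∑ j, Γ.area j * ∑ k, f j ((Γ.facet j).points k)

/-- `∇_s X : ∇_s Y = ∑_i ∂_{t_i} X · ∂_{t_i} Y` with `t_i` an orthonormal basis of the tangent
space of the simplex. -/
def surfGradInner (s : Affine.Simplex ℝ (Pt n) n) (X Y : Pt n → Pt n) (x : Pt n) : ℝ :=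
  ∑ i, inner ℝ (lineDeriv ℝ X x (stdOrthonormalBasis ℝ (vectorSpan ℝ (range s.points)) i : Pt n))
    (lineDeriv ℝ Y x (stdOrthonormalBasis ℝ (vectorSpan ℝ (range s.points)) i : Pt n))

/-- The vertices of the surface mesh. -/
def Interface.vertices (Γ : Interface n) : Set (Pt n) := ⋃ j, range (Γ.facet j).points

open Classical in
/-- The area weighted normal at a vertex `q`. -/
def Interface.vertexNormal (Γ : Interface n) (q : Pt n) : Pt n :=
  ((μHE[n]).real (⋃ j ∈ {j | q ∈ (Γ.facet j).closedInterior}, (Γ.facet j).closedInterior))⁻¹ •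
    ∑ j with q ∈ (Γ.facet j).closedInterior, Γ.area j • Γ.normal j

/-- The nondegeneracy assumption on one surface: the simplices have positive area, the surface lies in the
closure of `Ω`, and the vertex normals span the whole space. -/
def Interface.Admissible (Γ : Interface n) (Ω : Set (Pt n)) : Prop :=
  (∀ j, 0 < Γ.area j) ∧ Γ.carrier ⊆ closure Ω ∧
    Module.finrank ℝ (Submodule.span ℝ (Γ.vertexNormal '' Γ.vertices)) = n + 1

/-! ### The discrete density and viscosity -/

/-- The two ways of assigning a coefficient to the elements cut by the interface. -/
inductive MixtureRule where
  | average
  | volumeFraction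

open Classical in
/-- The piecewise constant coefficient with value `aIn` on elements inside, `aOut` on elements
outside, and on the elements cut by the interface either the arithmetic mean or the mean
weighted by volume fractions. -/
def phaseCoeff (rule : MixtureRule) (𝒯 : BulkMesh n Ω) (Γ : Interface n) (aIn aOut : ℝ) :
    Pt n → ℝ :=
  match rule with
  | .average => 𝒯.pwConst fun j =>
      if 𝒯.cell j ⊆ Γ.inside then aIn
      else if 𝒯.cell j ⊆ Γ.outside then aOut
      else (aIn + aOut) / 2
  | .volumeFraction => 𝒯.pwConst fun j =>
      volume.real (𝒯.cell j ∩ Γ.inside) / volume.real (𝒯.cell j) * aIn +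
        (1 - volume.real (𝒯.cell j ∩ Γ.inside) / volume.real (𝒯.cell j)) * aOut

/-! ### The continuous and the discrete problem -/

/-- The data of the two-phase flow problem in dimension `n + 1`. The indices `In` and `Out` stand
for the phases `-` and `+`; `noSlip` and `slip` are the two parts of the boundary. The domain is
polyhedral as soon as it carries a `BulkMesh`; `interior_closure` excludes slits. -/
structure FlowData (n : ℕ) where
  Ω : Set (Pt n)
  isOpen : IsOpen Ω
  isConnected : IsConnected Ω
  interior_closure : interior (closure Ω) = Ω
  noSlip : Set (Pt n)
  slip : Set (Pt n)
  boundary_eq : noSlip ∪ slip = frontier Ω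
  boundary_disjoint : Disjoint noSlip slip
  measurable_noSlip : MeasurableSet noSlip
  measurable_slip : MeasurableSet slip
  ρIn : ℝ
  ρOut : ℝ
  μIn : ℝ
  μOut : ℝ
  γ : ℝ
  β : ℝ
  ρIn_nonneg : 0 ≤ ρIn
  ρOut_nonneg : 0 ≤ ρOut
  μIn_pos : 0 < μIn
  μOut_pos : 0 < μOut
  γ_pos : 0 < γ
  β_nonneg : 0 ≤ β
  T : ℝ
  /-- The forcing is `ρ f₁ + f₂`; the first argument is time. -/
  f₁ : ℝ → Pt n → Pt n
  f₂ : ℝ → Pt n → Pt n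

/-- The boundary conditions that define the velocity space inside `H¹(Ω)`. -/
def FlowData.VelocityBC (D : FlowData n) (φ : Pt n → Pt n) : Prop :=
  (∀ᵐ x ∂(μHE[n]).restrict D.noSlip, φ x = 0) ∧
    ∀ᵐ x ∂(μHE[n]).restrict D.slip, inner ℝ (φ x) (outerNormal D.Ω x) = 0

/-- The energy `½ (ξ V, V) + γ H^{d-1}(ℳ)`. -/
def FlowData.energy (D : FlowData n) (ξ : Pt n → ℝ) (V : Pt n → Pt n) (ℳ : Set (Pt n)) : ℝ :=
  1 / 2 * wInner D.Ω ξ V V + D.γ * (μHE[n]).real ℳ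

/-- A discretization: an arbitrary partition `0 = t_0 < ⋯ < t_M = T`, and for every time level a
bulk mesh, a velocity space (conforming piecewise polynomials), a pressure space, and
the rule for the coefficients on cut elements. Only the levels below `M` matter. -/
structure Discretization (D : FlowData n) where
  M : ℕ
  t : ℕ → ℝ
  M_pos : 0 < M
  t_zero : t 0 = 0
  t_last : t M = D.T
  t_lt : ∀ m < M, t m < t (m + 1)
  mesh : ℕ → BulkMesh n D.Ω
  velSpace : ℕ → Submodule ℝ (Pt n → Pt n)
  velSpace_poly : ∀ m < M, ∃ k, ∀ φ ∈ velSpace m, (mesh m).IsPiecewisePoly k φ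
  velSpace_bc : ∀ m < M, ∀ φ ∈ velSpace m, D.VelocityBC φ
  presSpace : ℕ → Submodule ℝ (Pt n → ℝ)
  presSpace_L2 : ∀ m < M, ∀ φ ∈ presSpace m, MemLp φ 2 (volume.restrict D.Ω)
  rule : MixtureRule

namespace Discretization

variable {D : FlowData n} (S : Discretization D) (Γ : ℕ → Interface n)

/-- The time step `τ_m`. -/
def τ (m : ℕ) : ℝ := S.t (m + 1) - S.t m

/-- Membership in the space of discrete pressures with zero mean. -/
def IsPressure (m : ℕ) (φ : Pt n → ℝ) : Prop :=
  φ ∈ S.presSpace m ∧ ∫ x in D.Ω, φ x = 0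

/-- The discrete density `ρ^m`. -/
def ρ (m : ℕ) : Pt n → ℝ := phaseCoeff S.rule (S.mesh m) (Γ m) D.ρIn D.ρOut

/-- The discrete viscosity `μ^m`. -/
def μ (m : ℕ) : Pt n → ℝ := phaseCoeff S.rule (S.mesh m) (Γ m) D.μIn D.μOut

/-- The lagged density `ρ^{m-1}`, with the convention `ρ^{-1} = ρ^0`. -/
def ρPrev : ℕ → Pt n → ℝ
  | 0 => S.ρ Γ 0
  | m + 1 => S.ρ Γ m

/-- The interpolated lagged density `I_0^m ρ^{m-1}`. -/
def ρLag (m : ℕ) : Pt n → ℝ := (S.mesh m).I0 (S.ρPrev Γ m)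

/-- The load `ρ^m f₁^{m+1} + f₂^{m+1}` with `f_i^{m+1} = I_2^m f_i(·, t_{m+1})`. -/
def load (m : ℕ) (x : Pt n) : Pt n :=
  S.ρ Γ m x • (S.mesh m).I2 (D.f₁ (S.t (m + 1))) x + (S.mesh m).I2 (D.f₂ (S.t (m + 1))) x

/-- The momentum equation of the scheme at step `m`, where `U₀` is the old velocity and
`(U₁, P, κ)` are the new velocity, pressure and curvature. -/
def Momentum (m : ℕ) (U₀ U₁ : Pt n → Pt n) (P κ : Pt n → ℝ) : Prop :=
  ∀ ξ ∈ S.velSpace m,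
    1 / 2 * (∫ x in D.Ω, inner ℝ
        ((S.τ m)⁻¹ • (S.ρ Γ m x • U₁ x - S.ρLag Γ m x • (S.mesh m).I2 U₀ x) +
          S.ρLag Γ m x • (S.τ m)⁻¹ • (U₁ x - (S.mesh m).I2 U₀ x)) (ξ x)) +
      2 * viscInner D.Ω (S.μ Γ m) U₁ ξ +
      1 / 2 * (∫ x in D.Ω, S.ρ Γ m x *
        (inner ℝ (convect ((S.mesh m).I2 U₀) U₁ x) (ξ x) -
          inner ℝ (convect ((S.mesh m).I2 U₀) ξ x) (U₁ x))) -
      (∫ x in D.Ω, P x * divergence ξ x) +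
      D.β * tangInner D.Ω D.slip U₁ ξ -
      D.γ * (Γ m).surfInt (fun j x => inner ℝ (κ x • (Γ m).normal j) (ξ x)) =
    ∫ x in D.Ω, inner ℝ (S.load Γ m x) (ξ x)

/-- The discrete incompressibility condition at step `m`. -/
def Incompressible (m : ℕ) (U₁ : Pt n → Pt n) : Prop :=
  ∀ φ, S.IsPressure m φ → ∫ x in D.Ω, divergence U₁ x * φ x = 0

/-- The discrete kinematic condition at step `m`; the old parametrization is the identity. -/
def Kinematic (m : ℕ) (U₁ X : Pt n → Pt n) : Prop :=
  ∀ χ : Pt n → ℝ, (Γ m).IsPL χ →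
    (Γ m).lumpInt (fun j x => inner ℝ ((S.τ m)⁻¹ • (X x - x)) (χ x • (Γ m).normal j)) -
      (Γ m).surfInt (fun j x => inner ℝ (U₁ x) (χ x • (Γ m).normal j)) = 0

/-- `(U, P, X, κ)` is a solution of the scheme for the initial data `Γ^0` and `U^0`, where
`Γ^m` is a triangulated surface and `X^{m+1}` parametrizes the new surface over `Γ^m`. -/
structure IsSolution (U : ℕ → Pt n → Pt n) (P : ℕ → Pt n → ℝ) (X : ℕ → Pt n → Pt n)
    (κ : ℕ → Pt n → ℝ) : Prop where
  initial : U 0 ∈ S.velSpace 0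
  velocity : ∀ m < S.M, U (m + 1) ∈ S.velSpace m
  pressure : ∀ m < S.M, S.IsPressure m (P (m + 1))
  position : ∀ m < S.M, (Γ m).IsPL (X (m + 1))
  curvature : ∀ m < S.M, (Γ m).IsPL (κ (m + 1))
  momentum : ∀ m < S.M, S.Momentum Γ m (U m) (U (m + 1)) (P (m + 1)) (κ (m + 1))
  incompressible : ∀ m < S.M, S.Incompressible m (U (m + 1))
  kinematic : ∀ m < S.M, S.Kinematic Γ m (U (m + 1)) (X (m + 1))
  curvature_eq : ∀ m < S.M, ∀ η : Pt n → Pt n, (Γ m).IsPL η →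
    (Γ m).lumpInt (fun j x => inner ℝ (κ (m + 1) x • (Γ m).normal j) (η x)) +
      (Γ m).surfInt (fun j x => surfGradInner ((Γ m).facet j) (X (m + 1)) η x) = 0
  next_surface : ∀ m, m + 1 < S.M → (Γ (m + 1)).carrier = X (m + 1) '' (Γ m).carrier

end Discretization

end TwoPhaseFEM

end

/-! The estimate comes from testing the scheme with its own solution: ξ = U^{m+1} in the momentum
equation, φ = P^{m+1} in the incompressibility condition, χ = κ^{m+1} in the kinematic condition and
η = X^{m+1} - id in the curvature equation. The convective term is antisymmetric and drops out, as
does the pressure. Completing the square in the discrete time derivative gives the new kinetic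
energy, minus the interpolated old one, plus a numerical dissipation term. The two surface equations
share the lumped term ⟨κν, X - id⟩^h, so τ⟨κν, U⟩ = -⟨∇_s X, ∇_s(X - id)⟩ (`IsSolution.area_le`). No
remainder has to be absorbed, hence no time step restriction.

The geometric core is |X(Γ)| - |Γ| ≤ ⟨∇_s X, ∇_s(X - id)⟩ (`Interface.measure_image_sub_le`). On
each simplex X is affine with constant Jacobian J, and for surfaces of dimension one or two J - 1 ≤
½ ∑ (|∂_i X|² - 1) ≤ ∑ ∂_i X · ∂_i(X - id) (`normDet_sub_one_le`).

The one-step bounds (`IsSolution.energy_step`) are then summed. Between steps the change of bulk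
mesh is paid for by the assumption on the interpolated kinetic energy; at the initial step no such
assumption is needed, because `I0` and `I2` reproduce the initial data (`wInner_ρLag_zero`). -/

noncomputable section

namespace TwoPhaseFEM

/-! ### Hausdorff measure of subsets of affine planes. -/

section Area

variable {V W : Type*} [NormedAddCommGroup V] [InnerProductSpace ℝ V]

/-- A set in an affine plane with direction `E` is a translate of a set in `E`. -/
theorem exists_eq_image_vadd_subtype {E : Submodule ℝ V} {C : Set V} {p : V}
    (hC : ∀ x ∈ C, x - p ∈ E) : ∃ T : Set E, C = (fun v : E => (v : V) + p) '' T := by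
  refine ⟨(fun v : E => (v : V) + p) ⁻¹' C, ?_⟩
  rw [image_preimage_eq_inter_range, eq_comm, inter_eq_left]
  exact fun x hx => ⟨⟨x - p, hC x hx⟩, by simp⟩

theorem isometry_subtype_add (E : Submodule ℝ V) (p : V) :
    Isometry fun v : E => (v : V) + p :=
  (isometry_add_right p).comp isometry_subtype_coe

variable [FiniteDimensional ℝ V] [MeasurableSpace V] [BorelSpace V] [NormedAddCommGroup W]
  [InnerProductSpace ℝ W] [MeasurableSpace W] [BorelSpace W]

/-- The area formula for the restriction of an affine map to a plane. -/
theorem euclideanHausdorffMeasure_affine_image {E : Submodule ℝ V} {C : Set V} {p : V}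
    (hC : ∀ x ∈ C, x - p ∈ E) (a : V →ᵃ[ℝ] W) :
    μHE[Module.finrank ℝ E] (a '' C) =
      ENNReal.ofReal (a.linear.domRestrict E).normDet * μHE[Module.finrank ℝ E] C := by
  obtain ⟨T, rfl⟩ := exists_eq_image_vadd_subtype hC
  -- Translations by `p` and by `a p` are isometries, so only the linear part on `E` changes the
  -- measure.
  rw [(isometry_subtype_add E p).euclideanHausdorffMeasure_image,
    ← LinearMap.euclideanHausdorffMeasure_image,
    ← (isometry_add_right (a p)).euclideanHausdorffMeasure_image (_ '' T), image_image, image_image]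
  congr 1
  refine image_congr fun v _ => ?_
  simpa using a.map_vadd p (v : V)

/-- Sets in planes of lower dimension are null sets. -/
theorem euclideanHausdorffMeasure_eq_zero_of_finrank_lt {E : Submodule ℝ V} {C : Set V} {p : V}
    (hC : ∀ x ∈ C, x - p ∈ E) {d : ℕ} (hd : Module.finrank ℝ E < d) : μHE[d] C = 0 := by
  obtain ⟨T, rfl⟩ := exists_eq_image_vadd_subtype hC
  rw [(isometry_subtype_add E p).euclideanHausdorffMeasure_image,
    Measure.euclideanHausdorffMeasure_def, Measure.smul_apply,
    Real.hausdorffMeasure_of_finrank_lt (E := E) (by exact_mod_cast hd)]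
  simp

/-- Bounded sets in a plane have finite area. -/
theorem euclideanHausdorffMeasure_lt_top {E : Submodule ℝ V} {C : Set V} {p : V}
    (hC : ∀ x ∈ C, x - p ∈ E) (hb : Bornology.IsBounded C) :
    μHE[Module.finrank ℝ E] C < ⊤ := by
  obtain ⟨T, rfl⟩ := exists_eq_image_vadd_subtype hC
  rw [(isometry_subtype_add E p).euclideanHausdorffMeasure_image,
    InnerProductSpace.euclideanHausdorffMeasure_eq_volume]
  exact ((isometry_subtype_add E p).antilipschitz.isBounded_preimage hb |>.subset
    (subset_preimage_image _ _)).measure_lt_top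

end Area

/-! ### Jacobian bounds in dimensions one and two. -/

section Jacobian

variable {U V : Type*} [NormedAddCommGroup U] [InnerProductSpace ℝ U] [FiniteDimensional ℝ U]
  [NormedAddCommGroup V] [InnerProductSpace ℝ V]

/-- Here J = ‖f b₀‖, and J - 1 ≤ ½(J² - 1) is (J - 1)² ≥ 0. -/
theorem normDet_le_of_finrank_eq_one (b : OrthonormalBasis (Fin 1) ℝ U) (f : U →ₗ[ℝ] V) :
    f.normDet - 1 ≤ 1 / 2 * (∑ i, ‖f (b i)‖ ^ 2 - ∑ i, ‖b i‖ ^ 2) := by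
  have h := f.normDet_sq_eq_det_gram b
  simp [Matrix.gram_apply] at h ⊢
  nlinarith [sq_nonneg (f.normDet - 1)]

/-- The Gram determinant gives J² ≤ ‖f b₀‖² ‖f b₁‖², and the arithmetic-geometric mean inequality
bounds J by half the sum of squares. In dimension three or more a dilation breaks such a bound,
since J then grows faster than quadratically. -/
theorem normDet_le_of_finrank_eq_two (b : OrthonormalBasis (Fin 2) ℝ U) (f : U →ₗ[ℝ] V) :
    f.normDet - 1 ≤ 1 / 2 * (∑ i, ‖f (b i)‖ ^ 2 - ∑ i, ‖b i‖ ^ 2) := by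
  have h := f.normDet_sq_eq_det_gram b
  simp [Matrix.gram_apply, Matrix.det_fin_two, Fin.sum_univ_two,
    real_inner_comm] at h ⊢
  have h' : f.normDet ≤ 1 / 2 * (‖f (b 0)‖ ^ 2 + ‖f (b 1)‖ ^ 2) := by
    refine (sq_le_sq₀ f.normDet_nonneg (by positivity)).1 ?_
    nlinarith [sq_nonneg (‖f (b 0)‖ ^ 2 - ‖f (b 1)‖ ^ 2), mul_self_nonneg (inner ℝ (f (b 0)) (f (b 1)))]
  linarith

/-- The growth of area under a linear map is controlled by the Dirichlet inner product of the map
and its displacement. -/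
theorem normDet_sub_one_le {E : Submodule ℝ U} (f : U →ₗ[ℝ] U) {n : ℕ}
    (hE : Module.finrank ℝ E = n) (hn : n = 1 ∨ n = 2)
    (b : OrthonormalBasis (Fin (Module.finrank ℝ E)) ℝ E) :
    (f.domRestrict E).normDet - 1 ≤ ∑ i, inner ℝ (f (b i)) (f (b i) - b i) := by
  have key : (f.domRestrict E).normDet - 1 ≤
      1 / 2 * (∑ i, ‖f (b i)‖ ^ 2 - ∑ i, ‖(b i : U)‖ ^ 2) := by
    have e (g : Fin (Module.finrank ℝ E) → ℝ) := Equiv.sum_comp (finCongr hE).symm g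
    rcases hn with rfl | rfl
    · have := normDet_le_of_finrank_eq_one (b.reindex (finCongr hE)) (f.domRestrict E)
      simpa only [OrthonormalBasis.reindex_apply, LinearMap.domRestrict_apply,
        e fun i => ‖f (b i)‖ ^ 2, e fun i => ‖(b i : U)‖ ^ 2, Submodule.coe_norm] using this
    · have := normDet_le_of_finrank_eq_two (b.reindex (finCongr hE)) (f.domRestrict E)
      simpa only [OrthonormalBasis.reindex_apply, LinearMap.domRestrict_apply,
        e fun i => ‖f (b i)‖ ^ 2, e fun i => ‖(b i : U)‖ ^ 2, Submodule.coe_norm] using this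
  refine key.trans ?_
  rw [← Finset.sum_sub_distrib, Finset.mul_sum]
  refine Finset.sum_le_sum fun i _ => ?_
  rw [inner_sub_right, real_inner_self_eq_norm_sq]
  -- The gap in ½(|a|² - |b|²) ≤ a · (a - b) is exactly ½|a - b|².
  have := norm_sub_sq_real (f (b i)) (b i)
  nlinarith [sq_nonneg ‖f (b i) - b i‖]

end Jacobian

/-! ### Measure and tangential calculus on a simplex. -/

section Simplex

variable {n : ℕ} {m : ℕ}

theorem closedInterior_sub_mem (s : Affine.Simplex ℝ (Pt n) m) :
    ∀ x ∈ s.closedInterior, x - s.points 0 ∈ vectorSpan ℝ (range s.points) := by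
  intro x hx
  have h := vsub_mem_vectorSpan_of_mem_affineSpan_of_mem_affineSpan
    (Affine.Simplex.closedInterior_subset_affineSpan hx)
    (mem_affineSpan ℝ (mem_range_self (f := s.points) 0))
  simpa using h

theorem finrank_vectorSpan_simplex (s : Affine.Simplex ℝ (Pt n) m) :
    Module.finrank ℝ (vectorSpan ℝ (range s.points)) = m :=
  s.independent.finrank_vectorSpan (by simp)

/-- The relative boundary of a simplex is a null set. -/
theorem measure_closedInterior_sdiff_interior [NeZero m] (s : Affine.Simplex ℝ (Pt n) m) :
    μHE[m] (s.closedInterior \ s.interior) = 0 := by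
  rw [s.closedInterior_sdiff_interior, measure_iUnion_null_iff]
  refine fun i => euclideanHausdorffMeasure_eq_zero_of_finrank_lt (closedInterior_sub_mem _) ?_
  rw [finrank_vectorSpan_simplex]
  exact Nat.sub_lt (NeZero.pos m) one_pos

theorem measure_closedInterior_eq [NeZero m] (s : Affine.Simplex ℝ (Pt n) m) :
    μHE[m] s.closedInterior = μHE[m] s.interior := by
  refine le_antisymm ?_ (measure_mono s.interior_subset_closedInterior)
  calc μHE[m] s.closedInterior
      = μHE[m] (s.interior ∪ s.closedInterior \ s.interior) := by
        rw [union_sdiff_cancel s.interior_subset_closedInterior]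
    _ ≤ μHE[m] s.interior + μHE[m] (s.closedInterior \ s.interior) := measure_union_le _ _
    _ = μHE[m] s.interior := by rw [measure_closedInterior_sdiff_interior, add_zero]

theorem measurableSet_interior_simplex [NeZero m] (s : Affine.Simplex ℝ (Pt n) m) :
    MeasurableSet s.interior := by
  rw [← sdiff_sdiff_eq_self s.interior_subset_closedInterior, s.closedInterior_sdiff_interior]
  exact s.isClosed_closedInterior.measurableSet.diff
    (MeasurableSet.iUnion fun i => (s.faceOpposite i).isClosed_closedInterior.measurableSet)

theorem measure_interior_lt_top (s : Affine.Simplex ℝ (Pt n) m) : μHE[m] s.interior < ⊤ := by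
  refine (measure_mono s.interior_subset_closedInterior).trans_lt ?_
  have := euclideanHausdorffMeasure_lt_top (closedInterior_sub_mem s)
    s.isCompact_closedInterior.isBounded
  rwa [finrank_vectorSpan_simplex] at this

/-- The relative interior of a simplex is relatively open. -/
theorem eventually_add_smul_mem_interior (s : Affine.Simplex ℝ (Pt n) m) {x v : Pt n}
    (hx : x ∈ s.interior) (hv : v ∈ vectorSpan ℝ (range s.points)) :
    ∀ᶠ t : ℝ in 𝓝 0, x + t • v ∈ s.interior := by
  obtain ⟨w, hw, hw01, rfl⟩ := hx
  -- A tangent direction is a weight vector of sum zero, so moving along it changes the barycentric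
  -- coordinates to w + t u, which stay in (0, 1) for small t.
  obtain ⟨u, hu, rfl⟩ : ∃ u : Fin (m + 1) → ℝ, ∑ i, u i = 0 ∧
      v = Finset.univ.weightedVSub s.points u := by
    obtain ⟨F, u, hu, rfl⟩ := (mem_vectorSpan_iff_eq_weightedVSub ℝ).1 hv
    exact ⟨Set.indicator F u, by rwa [Finset.sum_indicator_subset _ F.subset_univ],
      Finset.weightedVSub_indicator_subset _ _ F.subset_univ⟩
  have hcont : ∀ᶠ t : ℝ in 𝓝 0, ∀ i, w i + t * u i ∈ Ioo (0 : ℝ) 1 := by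
    refine eventually_all.2 fun i => ?_
    have : ContinuousAt (fun t : ℝ => w i + t * u i) 0 := by fun_prop
    exact this.eventually_mem (by simpa using Ioo_mem_nhds (hw01 i).1 (hw01 i).2)
  filter_upwards [hcont] with t ht
  refine ⟨w + t • u, ?_, fun i => by simpa using ht i, ?_⟩
  · simp [Finset.sum_add_distrib, ← Finset.mul_sum, hw, hu]
  · have := Finset.univ.weightedVSub_vadd_affineCombination (t • u) w s.points
    rw [add_comm w, ← this, map_smul, vadd_eq_add, add_comm]

/-- From a relative interior point, short tangential segments stay in the simplex, so values of X
off the surface do not affect its tangential derivatives. -/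
theorem lineDeriv_eq_of_eqOn (s : Affine.Simplex ℝ (Pt n) m) {X : Pt n → Pt n}
    {a : Pt n →ᵃ[ℝ] Pt n} (hX : EqOn X a s.closedInterior) {x v : Pt n} (hx : x ∈ s.interior)
    (hv : v ∈ vectorSpan ℝ (range s.points)) : lineDeriv ℝ X x v = a.linear v := by
  have h : (fun t : ℝ => X (x + t • v)) =ᶠ[𝓝 0] fun t => a x + t • a.linear v := by
    filter_upwards [eventually_add_smul_mem_interior s hx hv] with t ht
    rw [hX (s.interior_subset_closedInterior ht), add_comm x]
    have := a.map_vadd x (t • v)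
    simpa [add_comm] using this
  rw [lineDeriv, h.deriv_eq]
  have : HasDerivAt (fun t : ℝ => a x + t • a.linear v) ((1 : ℝ) • a.linear v) 0 :=
    ((hasDerivAt_id (0 : ℝ)).smul_const _).const_add _
  simpa using this.deriv

end Simplex

/-! ### Growth of area of a polyhedral surface. -/

section Surface

variable {n : ℕ}

theorem Interface.IsPL.sub_id {Γ : Interface n} {X : Pt n → Pt n} (hX : Γ.IsPL X) :
    Γ.IsPL fun x => X x - x := by
  refine ⟨hX.1.sub continuousOn_id, fun j => ?_⟩
  obtain ⟨a, ha⟩ := hX.2 j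
  exact ⟨a - AffineMap.id ℝ (Pt n), fun x hx => by simp [ha hx]⟩

/-- On one simplex, the growth of area is controlled by the Dirichlet inner product of the
parametrization and its displacement. -/
theorem measure_image_facet_le [NeZero n] (hn : n = 1 ∨ n = 2) (s : Affine.Simplex ℝ (Pt n) n)
    {X : Pt n → Pt n} (hX : ∃ a : Pt n →ᵃ[ℝ] Pt n, EqOn X a s.closedInterior) :
    (μHE[n]).real (X '' s.closedInterior) - (μHE[n]).real s.interior ≤
      ∫ x in s.interior, surfGradInner s X (fun x => X x - x) x ∂μHE[n] := by
  obtain ⟨a, ha⟩ := hX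
  have hE := finrank_vectorSpan_simplex s
  have himg : μHE[n] (X '' s.closedInterior) = ENNReal.ofReal
      (a.linear.domRestrict (vectorSpan ℝ (range s.points))).normDet * μHE[n] s.interior := by
    have := euclideanHausdorffMeasure_affine_image (closedInterior_sub_mem s) a
    rw [hE, measure_closedInterior_eq] at this
    rw [ha.image_eq, this]
  have hgrad : ∀ x ∈ s.interior, surfGradInner s X (fun x => X x - x) x =
      ∑ i, inner ℝ (a.linear (stdOrthonormalBasis ℝ (vectorSpan ℝ (range s.points)) i))
        (a.linear (stdOrthonormalBasis ℝ (vectorSpan ℝ (range s.points)) i) -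
          stdOrthonormalBasis ℝ (vectorSpan ℝ (range s.points)) i) := by
    intro x hx
    refine Finset.sum_congr rfl fun i _ => ?_
    have hd : EqOn (fun x => X x - x) (a - AffineMap.id ℝ (Pt n) : Pt n →ᵃ[ℝ] Pt n)
        s.closedInterior := fun x hx => by simp [ha hx]
    rw [lineDeriv_eq_of_eqOn s ha hx (Subtype.coe_prop _),
      lineDeriv_eq_of_eqOn s hd hx (Subtype.coe_prop _)]
    simp
  rw [setIntegral_congr_fun (measurableSet_interior_simplex s) hgrad, setIntegral_const]
  rw [measureReal_def, himg, ENNReal.toReal_mul,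
    ENNReal.toReal_ofReal (LinearMap.normDet_nonneg _), ← measureReal_def, smul_eq_mul]
  have := mul_le_mul_of_nonneg_left (normDet_sub_one_le a.linear hE hn
    (stdOrthonormalBasis ℝ (vectorSpan ℝ (range s.points))))
    (measureReal_nonneg (μ := μHE[n]) (s := s.interior))
  linarith

/-- The growth of area of a polyhedral surface is controlled by the Dirichlet inner product of the
parametrization and its displacement. -/
theorem Interface.measure_image_sub_le (hn : n = 1 ∨ n = 2) (Γ : Interface n) {X : Pt n → Pt n}
    (hX : Γ.IsPL X) :
    (μHE[n]).real (X '' Γ.carrier) - (μHE[n]).real Γ.carrier ≤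
      Γ.surfInt fun j x => surfGradInner (Γ.facet j) X (fun x => X x - x) x := by
  have : NeZero n := ⟨by omega⟩
  -- Subadditivity suffices for the image, so the image simplices may overlap; the lower bound for
  -- the old surface uses disjointness.
  have himg : (μHE[n]).real (X '' Γ.carrier) ≤
      ∑ j, (μHE[n]).real (X '' (Γ.facet j).closedInterior) := by
    rw [Interface.carrier, image_iUnion]
    exact measureReal_iUnion_fintype_le _
  have hold : ∑ j, (μHE[n]).real (Γ.facet j).interior ≤ (μHE[n]).real Γ.carrier := by
    have hfin : μHE[n] Γ.carrier < ⊤ := by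
      refine (measure_iUnion_fintype_le _ _).trans_lt (ENNReal.sum_lt_top.2 fun j _ => ?_)
      rw [measure_closedInterior_eq]
      exact measure_interior_lt_top _
    rw [← measureReal_iUnion_fintype Γ.disjoint
      (fun j => measurableSet_interior_simplex _) (fun j => (measure_interior_lt_top _).ne)]
    exact measureReal_mono
      (iUnion_mono fun j => (Γ.facet j).interior_subset_closedInterior) hfin.ne
  calc _ ≤ ∑ j, ((μHE[n]).real (X '' (Γ.facet j).closedInterior) -
          (μHE[n]).real (Γ.facet j).interior) := by
        rw [Finset.sum_sub_distrib]
        linarith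
    _ ≤ _ := Finset.sum_le_sum fun j _ => measure_image_facet_le hn _ (hX.2 j)

end Surface

variable {n : ℕ} {Ω : Set (Pt n)}

/-! ### Bulk elements, null skeleton and boundedness of discrete functions. -/

section Cells

theorem interior_eq_setOf_coord_pos (s : Affine.Simplex ℝ (Pt n) (n + 1)) :
    s.interior = {x | ∀ a, 0 < (simplexBasis s).coord a x} := by
  ext x
  have hx := (simplexBasis s).affineCombination_coord_eq_self x
  have h1 := (simplexBasis s).sum_coord_apply_eq_one x
  have hmem : x ∈ s.interior ↔ ∀ a, (simplexBasis s).coord a x ∈ Ioo (0 : ℝ) 1 := by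
    conv_lhs => rw [← hx]
    exact Affine.Simplex.affineCombination_mem_setInterior_iff h1
  rw [hmem]
  refine ⟨fun h a => (h a).1, fun h a => ⟨h a, ?_⟩⟩
  -- A second positive coordinate keeps the first below 1, as they all sum to 1.
  obtain ⟨b, hb⟩ := exists_ne a
  rw [← h1]
  exact Finset.single_lt_sum hb (Finset.mem_univ a) (Finset.mem_univ b) (h b)
    fun c _ _ => (h c).le

theorem interior_closedInterior (s : Affine.Simplex ℝ (Pt n) (n + 1)) :
    interior s.closedInterior = s.interior := by
  rw [interior_eq_setOf_coord_pos, ← AffineBasis.interior_convexHull,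
    ← Affine.Simplex.convexHull_eq_closedInterior]
  rfl

theorem isOpen_interior_simplex (s : Affine.Simplex ℝ (Pt n) (n + 1)) : IsOpen s.interior :=
  interior_closedInterior s ▸ isOpen_interior

theorem nonempty_interior_simplex (s : Affine.Simplex ℝ (Pt n) (n + 1)) : s.interior.Nonempty := by
  rw [← interior_closedInterior, ← Affine.Simplex.convexHull_eq_closedInterior]
  exact ⟨_, (simplexBasis s).centroid_mem_interior_convexHull⟩

theorem closedInterior_subset_closure_interior (s : Affine.Simplex ℝ (Pt n) (n + 1)) :
    s.closedInterior ⊆ closure s.interior := by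
  have hc : Convex ℝ s.closedInterior := by
    rw [← Affine.Simplex.convexHull_eq_closedInterior]
    exact convex_convexHull _ _
  rw [← interior_closedInterior, hc.closure_interior_eq_closure_of_nonempty_interior]
  · exact subset_closure
  · rw [interior_closedInterior]
    exact nonempty_interior_simplex s

theorem volume_eq_euclideanHausdorffMeasure : (volume : Measure (Pt n)) = μHE[n + 1] :=
  (EuclideanSpace.euclideanHausdorffMeasure_eq_volume (n + 1)).symm

namespace BulkMesh

variable (𝒯 : BulkMesh n Ω)

theorem isOpen_cell (j : Fin 𝒯.J) : IsOpen (𝒯.cell j) := isOpen_interior_simplex _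

theorem closedInterior_subset (j : Fin 𝒯.J) : (𝒯.elem j).closedInterior ⊆ closure Ω := by
  rw [𝒯.closure_eq]
  exact subset_iUnion (fun j => (𝒯.elem j).closedInterior) j

theorem isCompact_closure (𝒯 : BulkMesh n Ω) : IsCompact (closure Ω) := by
  rw [𝒯.closure_eq]
  exact isCompact_iUnion fun j => (𝒯.elem j).isCompact_closedInterior

theorem volume_cell_ne_zero (j : Fin 𝒯.J) : volume.real (𝒯.cell j) ≠ 0 := by
  refine (ENNReal.toReal_pos ?_ ?_).ne'
  · exact ((𝒯.isOpen_cell j).measure_pos volume (nonempty_interior_simplex _)).ne'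
  · refine ((measure_mono (𝒯.elem j).interior_subset_closedInterior).trans_lt ?_).ne
    exact (𝒯.elem j).isCompact_closedInterior.measure_lt_top

/-- The skeleton of the mesh is a null set. -/
theorem ae_mem_cell_of_mem_closedInterior :
    ∀ᵐ x : Pt n, ∀ j, x ∈ (𝒯.elem j).closedInterior → x ∈ 𝒯.cell j := by
  rw [ae_all_iff]
  intro j
  have h : volume ((𝒯.elem j).closedInterior \ (𝒯.elem j).interior) = 0 := by
    rw [volume_eq_euclideanHausdorffMeasure]
    exact measure_closedInterior_sdiff_interior _
  filter_upwards [measure_eq_zero_iff_ae_notMem.1 h] with x hx hxj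
  by_contra hx'
  exact hx ⟨hxj, hx'⟩

theorem sum_indicator_cell {F : Type*} [AddCommMonoid F] (g : Fin 𝒯.J → Pt n → F) {j : Fin 𝒯.J}
    {x : Pt n} (hx : x ∈ 𝒯.cell j) : ∑ i, (𝒯.cell i).indicator (g i) x = g j x := by
  rw [Finset.sum_eq_single j, indicator_of_mem hx]
  · exact fun i _ hij => indicator_of_notMem
      (fun hxi => disjoint_left.1 (𝒯.disjoint hij) hxi hx) _
  · simp

theorem pwConst_apply (c : Fin 𝒯.J → ℝ) {j : Fin 𝒯.J} {x : Pt n} (hx : x ∈ 𝒯.cell j) :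
    𝒯.pwConst c x = c j :=
  𝒯.sum_indicator_cell (fun j _ => c j) hx

theorem I0_pwConst (c : Fin 𝒯.J → ℝ) : 𝒯.I0 (𝒯.pwConst c) = 𝒯.pwConst c := by
  rw [I0]
  congr 1
  funext j
  rw [setIntegral_congr_fun (𝒯.isOpen_cell j).measurableSet
    (fun x hx => 𝒯.pwConst_apply c hx), setIntegral_const, smul_eq_mul,
    inv_mul_cancel_left₀ (𝒯.volume_cell_ne_zero j)]

/-- Almost everywhere, the nodal interpolant is the one on the element containing the point. -/
theorem I2_ae (hΩ : IsOpen Ω) (η : Pt n → Pt n) : ∀ᵐ x ∂volume.restrict Ω, ∃ j, x ∈ 𝒯.cell j ∧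
    𝒯.I2 η x = quadInterp (𝒯.elem j) η x := by
  filter_upwards [ae_restrict_of_ae 𝒯.ae_mem_cell_of_mem_closedInterior,
    ae_restrict_mem hΩ.measurableSet] with x hx hxΩ
  have h : ∃ j, x ∈ (𝒯.elem j).closedInterior := by
    simpa only [𝒯.closure_eq, mem_iUnion] using subset_closure hxΩ
  -- Off the skeleton, the closed element selected by `I2` contains x in its interior.
  refine ⟨h.choose, hx _ h.choose_spec, ?_⟩
  rw [I2, dif_pos h]

theorem memLp_top_indicator_cell {F : Type*} [NormedAddCommGroup F] {g : Pt n → F}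
    (hg : Continuous g) (j : Fin 𝒯.J) (ν : Measure (Pt n)) :
    MemLp ((𝒯.cell j).indicator g) ⊤ ν := by
  obtain ⟨C, hC⟩ := (𝒯.elem j).isCompact_closedInterior.exists_bound_of_continuousOn
    hg.continuousOn
  refine memLp_top_of_bound (hg.aestronglyMeasurable.indicator (𝒯.isOpen_cell j).measurableSet)
    (max C 0) (ae_of_all _ fun x => ?_)
  by_cases hx : x ∈ 𝒯.cell j
  · rw [indicator_of_mem hx]
    exact (hC x ((𝒯.elem j).interior_subset_closedInterior hx)).trans (le_max_left _ _)
  · rw [indicator_of_notMem hx, norm_zero]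
    exact le_max_right _ _

theorem memLp_pwConst (c : Fin 𝒯.J → ℝ) (ν : Measure (Pt n)) : MemLp (𝒯.pwConst c) ⊤ ν :=
  memLp_finsetSum _ fun j _ => 𝒯.memLp_top_indicator_cell continuous_const j ν

theorem continuous_quadInterp (s : Affine.Simplex ℝ (Pt n) (n + 1)) (η : Pt n → Pt n) :
    Continuous (quadInterp s η) := by
  have h a := continuous_barycentric_coord (simplexBasis s) a
  unfold quadInterp
  fun_prop

/-- `I2` depends on a choice of element; measurability comes from its a.e. equality with a finite
sum of cellwise polynomials. -/
theorem memLp_I2 (hΩ : IsOpen Ω) (η : Pt n → Pt n) : MemLp (𝒯.I2 η) ⊤ (volume.restrict Ω) := by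
  have h : MemLp (fun x => ∑ j, (𝒯.cell j).indicator (quadInterp (𝒯.elem j) η) x) ⊤
      (volume.restrict Ω) :=
    memLp_finsetSum _ fun j _ => 𝒯.memLp_top_indicator_cell (continuous_quadInterp _ η) j _
  refine h.ae_eq ?_
  filter_upwards [𝒯.I2_ae hΩ η] with x ⟨j, hj, hx⟩
  rw [hx, 𝒯.sum_indicator_cell _ hj]

theorem IsPiecewisePoly.memLp {𝒯 : BulkMesh n Ω} (hΩ : IsOpen Ω) {k : ℕ} {φ : Pt n → Pt n}
    (hφ : 𝒯.IsPiecewisePoly k φ) : MemLp φ ⊤ (volume.restrict Ω) := by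
  obtain ⟨C, hC⟩ := 𝒯.isCompact_closure.exists_bound_of_continuousOn hφ.1
  refine memLp_top_of_bound ((hφ.1.mono subset_closure).aestronglyMeasurable hΩ.measurableSet) C ?_
  filter_upwards [ae_restrict_mem hΩ.measurableSet] with x hx using hC x (subset_closure hx)

end BulkMesh

end Cells

/-! ### Exactness of quadratic Lagrange interpolation. -/

section Interpolation

/-- Symmetry turns the sum over edges into a full double sum, which factorises, minus its diagonal.
-/
theorem sum_sum_Ioi_eq {ι : Type*} [Fintype ι] [LinearOrder ι] [LocallyFiniteOrderTop ι]
    (f : ι → ι → ℝ) (hf : ∀ a b, f a b = f b a) :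
    2 * ∑ a, ∑ b ∈ Finset.Ioi a, f a b = ∑ a, ∑ b, f a b - ∑ a, f a a := by
  have h1 : ∑ a, ∑ b, f a b = ∑ a, ∑ b, (if a < b then f a b else 0) +
      ∑ a, ∑ b, (if b < a then f a b else 0) + ∑ a, f a a := by
    rw [← Finset.sum_add_distrib, ← Finset.sum_add_distrib]
    refine Finset.sum_congr rfl fun a _ => ?_
    have : f a a = ∑ b, if a = b then f a b else 0 := by simp
    rw [this, ← Finset.sum_add_distrib, ← Finset.sum_add_distrib]
    refine Finset.sum_congr rfl fun b _ => ?_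
    rcases lt_trichotomy a b with h | h | h
    · simp [h, h.not_gt, h.ne]
    · simp [h]
    · simp [h, h.not_gt, h.ne']
  have h2 : ∑ a, ∑ b, (if b < a then f a b else 0) = ∑ a, ∑ b, if a < b then f a b else 0 := by
    rw [Finset.sum_comm]
    exact Finset.sum_congr rfl fun a _ => Finset.sum_congr rfl fun b _ => by rw [hf]
  rw [h1, h2]
  simp only [← Finset.filter_lt_eq_Ioi, Finset.sum_filter]
  ring

/-- Quadratic Lagrange interpolation is exact on products of two affine functions. -/
theorem quadratic_lagrange_mul {ι : Type*} [Fintype ι] [LinearOrder ι] [LocallyFiniteOrderTop ι]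
    (c l m : ι → ℝ) (hc : ∑ a, c a = 1) :
    ∑ a, c a * (2 * c a - 1) * (l a * m a) +
      ∑ a, ∑ b ∈ Finset.Ioi a, 4 * c a * c b * ((l a + l b) / 2 * ((m a + m b) / 2)) =
    (∑ a, c a * l a) * ∑ a, c a * m a := by
  have h := sum_sum_Ioi_eq (fun a b => 4 * c a * c b * ((l a + l b) / 2 * ((m a + m b) / 2)))
    fun a b => by ring
  have h1 : ∀ a b, 4 * c a * c b * ((l a + l b) / 2 * ((m a + m b) / 2)) =
      (c a * l a * m a) * c b + (c a * l a) * (c b * m b) + (c a * m a) * (c b * l b) +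
        c a * (c b * l b * m b) := fun a b => by ring
  have h2 : ∀ a, 4 * c a * c a * ((l a + l a) / 2 * ((m a + m a) / 2)) =
      2 * (c a * (2 * c a - 1) * (l a * m a)) + 2 * (c a * l a * m a) := fun a => by ring
  have h3 : ∑ a, ∑ b, 4 * c a * c b * ((l a + l b) / 2 * ((m a + m b) / 2)) =
      2 * ∑ a, c a * l a * m a + 2 * ((∑ a, c a * l a) * ∑ a, c a * m a) := by
    simp only [h1, Finset.sum_add_distrib, ← Finset.mul_sum, ← Finset.sum_mul, hc]
    ring
  have h4 : ∑ a, 4 * c a * c a * ((l a + l a) / 2 * ((m a + m a) / 2)) =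
      2 * ∑ a, c a * (2 * c a - 1) * (l a * m a) + 2 * ∑ a, c a * l a * m a := by
    simp only [h2, Finset.sum_add_distrib, ← Finset.mul_sum]
  linarith

/-- The scalar quadratic Lagrange interpolant on one simplex. -/
def scalarQuadInterp (s : Affine.Simplex ℝ (Pt n) (n + 1)) (f : Pt n → ℝ) (x : Pt n) : ℝ :=
  ∑ a, (simplexBasis s).coord a x * (2 * (simplexBasis s).coord a x - 1) * f (s.points a) +
    ∑ a, ∑ b ∈ Finset.Ioi a, 4 * (simplexBasis s).coord a x * (simplexBasis s).coord b x *
      f (midpoint ℝ (s.points a) (s.points b))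

theorem quadInterp_apply (s : Affine.Simplex ℝ (Pt n) (n + 1)) (η : Pt n → Pt n) (x : Pt n)
    (i : Fin (n + 1)) : quadInterp s η x i = scalarQuadInterp s (fun y => η y i) x := by
  simp [quadInterp, scalarQuadInterp]

theorem scalarQuadInterp_mul_affine (s : Affine.Simplex ℝ (Pt n) (n + 1)) (l m : Pt n →ᵃ[ℝ] ℝ)
    (x : Pt n) : scalarQuadInterp s (fun y => l y * m y) x = l x * m x := by
  have hval (g : Pt n →ᵃ[ℝ] ℝ) : g x = ∑ a, (simplexBasis s).coord a x * g (s.points a) := by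
    conv_lhs => rw [← (simplexBasis s).affineCombination_coord_eq_self x]
    rw [Finset.map_affineCombination _ _ _ ((simplexBasis s).sum_coord_apply_eq_one x),
      Finset.affineCombination_eq_linear_combination _ _ _
        ((simplexBasis s).sum_coord_apply_eq_one x)]
    rfl
  have hmid (g : Pt n →ᵃ[ℝ] ℝ) (p q : Pt n) : g (midpoint ℝ p q) = (g p + g q) / 2 := by
    rw [g.map_midpoint, midpoint_eq_smul_add, smul_eq_mul, invOf_eq_inv]
    ring
  rw [hval l, hval m, scalarQuadInterp]
  simp only [hmid]
  exact quadratic_lagrange_mul _ _ _ ((simplexBasis s).sum_coord_apply_eq_one x)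

theorem isLinearMap_scalarQuadInterp (s : Affine.Simplex ℝ (Pt n) (n + 1)) (x : Pt n) :
    IsLinearMap ℝ fun f : Pt n → ℝ => scalarQuadInterp s f x where
  map_add f g := by
    simp only [scalarQuadInterp, Pi.add_apply, mul_add, Finset.sum_add_distrib]
    ring
  map_smul c f := by
    simp only [scalarQuadInterp, Pi.smul_apply, smul_eq_mul, mul_add, Finset.mul_sum,
      mul_left_comm c]

/-- A monomial of degree at most two is a product of two affine functions. -/
theorem exists_affine_mul_eq_prod (d : Fin (n + 1) →₀ ℕ) (hd : (d.sum fun _ e => e) ≤ 2) :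
    ∃ l m : Pt n →ᵃ[ℝ] ℝ, ∀ x : Pt n, ∏ i ∈ d.support, x i ^ d i = l x * m x := by
  have hprod (x : Pt n) : ∏ i ∈ d.support, x i ^ d i = (d.toMultiset.map fun i => x i).prod := by
    simp [Finset.prod_multiset_map_count]
  have hcard : d.toMultiset.card ≤ 2 := by rwa [Finsupp.card_toMultiset]
  let coordMap (i : Fin (n + 1)) : Pt n →ᵃ[ℝ] ℝ :=
    (EuclideanSpace.proj i : Pt n →L[ℝ] ℝ).toLinearMap.toAffineMap
  simp only [hprod]
  -- A monomial is now a multiset of at most two variables; missing factors are filled by the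
  -- constant 1.
  generalize d.toMultiset = M at hcard
  interval_cases h : M.card
  · rw [Multiset.card_eq_zero.1 h]
    exact ⟨AffineMap.const ℝ _ 1, AffineMap.const ℝ _ 1, by simp⟩
  · obtain ⟨i, rfl⟩ := Multiset.card_eq_one.1 h
    exact ⟨coordMap i, AffineMap.const ℝ _ 1, by simp [coordMap]⟩
  · obtain ⟨i, j, rfl⟩ := Multiset.card_eq_two.1 h
    exact ⟨coordMap i, coordMap j, by simp [coordMap]⟩

/-- Quadratic Lagrange interpolation is exact on quadratic polynomials. -/
theorem scalarQuadInterp_polynomial (s : Affine.Simplex ℝ (Pt n) (n + 1))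
    {p : MvPolynomial (Fin (n + 1)) ℝ} (hp : p.totalDegree ≤ 2) (x : Pt n) :
    scalarQuadInterp s (fun y => MvPolynomial.eval (fun l => y l) p) x =
      MvPolynomial.eval (fun l => x l) p := by
  have hsum : (fun y : Pt n => MvPolynomial.eval (fun l => y l) p) =
      ∑ d ∈ p.support, p.coeff d • fun y : Pt n => ∏ i ∈ d.support, y i ^ d i := by
    ext y
    simp [MvPolynomial.eval_eq]
  have hlin := map_sum (isLinearMap_scalarQuadInterp s x).mk'
    (fun d => p.coeff d • fun y : Pt n => ∏ i ∈ d.support, y i ^ d i) p.support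
  simp only [IsLinearMap.mk'_apply] at hlin
  rw [hsum, hlin, MvPolynomial.eval_eq]
  refine Finset.sum_congr rfl fun d hd => ?_
  rw [(isLinearMap_scalarQuadInterp s x).map_smul, smul_eq_mul]
  obtain ⟨l, m, hlm⟩ := exists_affine_mul_eq_prod d ((MvPolynomial.le_totalDegree hd).trans hp)
  simp only [hlm, scalarQuadInterp_mul_affine]

/-- Nodal interpolation reproduces continuous piecewise quadratics. -/
theorem BulkMesh.IsPiecewisePoly.I2_ae_eq {𝒯 : BulkMesh n Ω} {φ : Pt n → Pt n}
    (hΩ : IsOpen Ω) (hφ : 𝒯.IsPiecewisePoly 2 φ) : 𝒯.I2 φ =ᵐ[volume.restrict Ω] φ := by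
  filter_upwards [𝒯.I2_ae hΩ φ] with x ⟨j, hj, hx⟩
  obtain ⟨p, hdeg, hp⟩ := hφ.2 j
  -- The nodes may lie on the boundary of the element, so the polynomial formula is first extended
  -- to the closed element by continuity.
  have hclosed : ∀ i, EqOn (fun y => φ y i) (fun y => MvPolynomial.eval (fun l => y l) (p i))
      (𝒯.elem j).closedInterior := by
    intro i
    refine EqOn.of_subset_closure (fun y hy => hp y hy i) ?_ ?_
      (𝒯.elem j).interior_subset_closedInterior (closedInterior_subset_closure_interior _)
    · have := hφ.1.mono (𝒯.closedInterior_subset j)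
      fun_prop
    · refine Continuous.continuousOn ?_
      exact (MvPolynomial.continuous_eval (p i)).comp (by fun_prop)
  have hmid (a b) : midpoint ℝ ((𝒯.elem j).points a) ((𝒯.elem j).points b) ∈
      (𝒯.elem j).closedInterior := by
    rw [← Affine.Simplex.convexHull_eq_closedInterior]
    exact (convex_convexHull ℝ _).midpoint_mem (subset_convexHull ℝ _ (mem_range_self a))
      (subset_convexHull ℝ _ (mem_range_self b))
  ext i
  rw [hx, quadInterp_apply, hp x hj i, ← scalarQuadInterp_polynomial (𝒯.elem j) (hdeg i) x]
  have hv a := hclosed i ((𝒯.elem j).point_mem_closedInterior a)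
  have hm a b := hclosed i (hmid a b)
  simp only [scalarQuadInterp] at hv hm ⊢
  simp only [hv, hm]

end Interpolation

/-! ### The energy law of a single time step. -/

theorem exists_phaseCoeff_eq_pwConst {Ω : Set (Pt n)} (rule : MixtureRule) (𝒯 : BulkMesh n Ω)
    (Γ : Interface n) (a b : ℝ) : ∃ c, phaseCoeff rule 𝒯 Γ a b = 𝒯.pwConst c := by
  cases rule <;> exact ⟨_, rfl⟩

/-- Only the kinetic integrals are ever split into summands, so integrability is needed for bounded
products alone. -/
theorem integrable_mul_inner {α V : Type*} [MeasurableSpace α] {ν : Measure α} [IsFiniteMeasure ν]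
    [NormedAddCommGroup V] [InnerProductSpace ℝ V] {a : α → ℝ} {u v : α → V} (ha : MemLp a ⊤ ν)
    (hu : MemLp u ⊤ ν) (hv : MemLp v ⊤ ν) : Integrable (fun x => a x * inner ℝ (u x) (v x)) ν := by
  have h : MemLp (fun x => inner ℝ (u x) (v x)) ⊤ ν := by
    refine MemLp.mono (hv.norm.mul (r := ⊤) hu.norm) (hu.1.inner hv.1) (ae_of_all _ fun x => ?_)
    exact (norm_inner_le_norm _ _).trans (le_abs_self _)
  exact (h.mul ha).integrable le_top

theorem surfInt_congr (Γ : Interface n) {f g : Fin Γ.J → Pt n → ℝ} (h : ∀ j x, f j x = g j x) :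
    Γ.surfInt f = Γ.surfInt g := by
  rw [show f = g from funext fun j => funext (h j)]

namespace Discretization

variable {D : FlowData n} (S : Discretization D) (Γ : ℕ → Interface n)

theorem τ_pos {m : ℕ} (hm : m < S.M) : 0 < S.τ m := sub_pos.2 (S.t_lt m hm)

theorem memLp_ρ (m : ℕ) (ν : Measure (Pt n)) : MemLp (S.ρ Γ m) ⊤ ν := by
  obtain ⟨c, hc⟩ := exists_phaseCoeff_eq_pwConst S.rule (S.mesh m) (Γ m) D.ρIn D.ρOut
  rw [ρ, hc]
  exact (S.mesh m).memLp_pwConst c ν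

/-- By the convention ρ^{-1} = ρ^0, the lagged density is already piecewise constant on the initial
mesh. -/
theorem ρLag_zero : S.ρLag Γ 0 = S.ρ Γ 0 := by
  obtain ⟨c, hc⟩ := exists_phaseCoeff_eq_pwConst S.rule (S.mesh 0) (Γ 0) D.ρIn D.ρOut
  rw [ρLag, ρPrev, ρ, hc, BulkMesh.I0_pwConst]

theorem memLp_velocity {m : ℕ} (hm : m < S.M) {φ : Pt n → Pt n} (hφ : φ ∈ S.velSpace m) :
    MemLp φ ⊤ (volume.restrict D.Ω) := by
  obtain ⟨k, hk⟩ := S.velSpace_poly m hm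
  exact (hk φ hφ).memLp D.isOpen

variable {S Γ}

/-- The discrete time derivative tested with the new velocity. -/
theorem integral_timeDerivative {m : ℕ} (hm : m < S.M) (U₀ : Pt n → Pt n) {U₁ : Pt n → Pt n}
    (hU₁ : U₁ ∈ S.velSpace m) :
    ∫ x in D.Ω, inner ℝ
        ((S.τ m)⁻¹ • (S.ρ Γ m x • U₁ x - S.ρLag Γ m x • (S.mesh m).I2 U₀ x) +
          S.ρLag Γ m x • (S.τ m)⁻¹ • (U₁ x - (S.mesh m).I2 U₀ x)) (U₁ x) =
      (S.τ m)⁻¹ * (wInner D.Ω (S.ρ Γ m) U₁ U₁ +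
        wInner D.Ω (S.ρLag Γ m) (fun x => U₁ x - (S.mesh m).I2 U₀ x)
          (fun x => U₁ x - (S.mesh m).I2 U₀ x) -
        wInner D.Ω (S.ρLag Γ m) ((S.mesh m).I2 U₀) ((S.mesh m).I2 U₀)) := by
  have : IsFiniteMeasure (volume.restrict D.Ω) := isFiniteMeasure_restrict.2
    ((measure_mono subset_closure).trans_lt (S.mesh m).isCompact_closure.measure_lt_top).ne
  have hU := S.memLp_velocity hm hU₁
  have hI := (S.mesh m).memLp_I2 D.isOpen U₀
  have hL : MemLp (S.ρLag Γ m) ⊤ (volume.restrict D.Ω) := (S.mesh m).memLp_pwConst _ _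
  have h1 := integrable_mul_inner (S.memLp_ρ Γ m _) hU hU
  have h2 : Integrable (fun x => S.ρLag Γ m x * inner ℝ (U₁ x - (S.mesh m).I2 U₀ x)
      (U₁ x - (S.mesh m).I2 U₀ x)) (volume.restrict D.Ω) :=
    integrable_mul_inner hL (hU.sub hI) (hU.sub hI)
  have h3 := integrable_mul_inner hL hI hI
  simp only [wInner]
  rw [← integral_add h1 h2, ← integral_sub (f := fun _ => _ + _) (h1.add h2) h3, ← integral_const_mul]
  refine integral_congr_ae (ae_of_all _ fun x => ?_)
  -- Pointwise, with a = `ρLag` and I the interpolant, a(|U₁|² - 2 I·U₁) = a|U₁ - I|² - a|I|².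
  simp only [inner_add_left, inner_sub_left, inner_sub_right, real_inner_smul_left,
    real_inner_comm (U₁ x) ((S.mesh m).I2 U₀ x)]
  ring

variable {U : ℕ → Pt n → Pt n} {P : ℕ → Pt n → ℝ} {X : ℕ → Pt n → Pt n} {κ : ℕ → Pt n → ℝ}

/-- The surface tension term controls the growth of the surface area. -/
theorem IsSolution.area_le (hn : n = 1 ∨ n = 2) (hsol : S.IsSolution Γ U P X κ) {m : ℕ}
    (hm : m < S.M) :
    S.τ m * (Γ m).surfInt (fun j x => inner ℝ (κ (m + 1) x • (Γ m).normal j) (U (m + 1) x)) ≤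
      (μHE[n]).real (Γ m).carrier - (μHE[n]).real (X (m + 1) '' (Γ m).carrier) := by
  have hX := hsol.position m hm
  have harea := (Γ m).measure_image_sub_le hn hX
  -- The test functions X - id and κ make the same lumped term appear in both surface equations.
  have hcurv := hsol.curvature_eq m hm _ hX.sub_id
  have hkin := hsol.kinematic m hm _ (hsol.curvature m hm)
  have hlump : (Γ m).lumpInt (fun j x => inner ℝ ((S.τ m)⁻¹ • (X (m + 1) x - x))
      (κ (m + 1) x • (Γ m).normal j)) = (S.τ m)⁻¹ * (Γ m).lumpInt (fun j x =>
        inner ℝ (κ (m + 1) x • (Γ m).normal j) (X (m + 1) x - x)) := by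
    simp only [Interface.lumpInt, real_inner_smul_left _ _ (S.τ m)⁻¹, ← Finset.mul_sum,
      mul_left_comm _ (S.τ m)⁻¹]
    simp only [real_inner_comm]
  have hsurf := surfInt_congr (Γ m) fun j x =>
    real_inner_comm (U (m + 1) x) (κ (m + 1) x • (Γ m).normal j)
  rw [hlump, ← hsurf, sub_eq_zero] at hkin
  have hτ := (S.τ_pos hm).ne'
  rw [← hkin, mul_inv_cancel_left₀ hτ]
  linarith

/-- The energy estimate for one time step. -/
theorem IsSolution.energy_step (hn : n = 1 ∨ n = 2) (hsol : S.IsSolution Γ U P X κ) {m : ℕ}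
    (hm : m < S.M) :
    D.energy (S.ρ Γ m) (U (m + 1)) (X (m + 1) '' (Γ m).carrier) +
        1 / 2 * (wInner D.Ω (S.ρLag Γ m) (fun x => U (m + 1) x - (S.mesh m).I2 (U m) x)
            (fun x => U (m + 1) x - (S.mesh m).I2 (U m) x) +
          4 * S.τ m * viscInner D.Ω (S.μ Γ m) (U (m + 1)) (U (m + 1)) +
          2 * D.β * S.τ m * tangInner D.Ω D.slip (U (m + 1)) (U (m + 1))) ≤
      D.energy (S.ρLag Γ m) ((S.mesh m).I2 (U m)) (Γ m).carrier +
        S.τ m * ∫ x in D.Ω, inner ℝ (S.load Γ m x) (U (m + 1) x) := by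
  have hmom := hsol.momentum m hm _ (hsol.velocity m hm)
  have hinc := hsol.incompressible m hm _ (hsol.pressure m hm)
  have harea := mul_le_mul_of_nonneg_left (hsol.area_le hn hm) D.γ_pos.le
  have hτ := S.τ_pos hm
  have hpres : ∫ x in D.Ω, P (m + 1) x * divergence (U (m + 1)) x = 0 := by
    simpa only [mul_comm] using hinc
  rw [integral_timeDerivative hm _ (hsol.velocity m hm), hpres] at hmom
  -- The convective integrand vanishes pointwise once ξ = U^{m+1}.
  simp only [sub_self, mul_zero, integral_zero, sub_zero, add_zero] at hmom
  rw [← hmom]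
  simp only [FlowData.energy]
  have hcancel : S.τ m * (S.τ m)⁻¹ = 1 := mul_inv_cancel₀ hτ.ne'
  generalize (wInner D.Ω (S.ρ Γ m) (U (m + 1)) (U (m + 1))) = A at *
  generalize (wInner D.Ω (S.ρLag Γ m) (fun x => U (m + 1) x - (S.mesh m).I2 (U m) x)
    (fun x => U (m + 1) x - (S.mesh m).I2 (U m) x)) = B at *
  generalize (wInner D.Ω (S.ρLag Γ m) ((S.mesh m).I2 (U m)) ((S.mesh m).I2 (U m))) = C at *
  linear_combination harea - 1 / 2 * (A + B - C) * hcancel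

/-- At the initial time, the interpolated kinetic energy is the initial kinetic energy. -/
theorem wInner_ρLag_zero (hU₀ : (S.mesh 0).IsPiecewisePoly 2 (U 0)) :
    wInner D.Ω (S.ρLag Γ 0) ((S.mesh 0).I2 (U 0)) ((S.mesh 0).I2 (U 0)) =
      wInner D.Ω (S.ρPrev Γ 0) (U 0) (U 0) := by
  refine integral_congr_ae ?_
  filter_upwards [hU₀.I2_ae_eq D.isOpen] with x hx
  rw [hx, ρLag_zero, ρPrev]

end Discretization

end TwoPhaseFEM

end

/-! ### Summation over the time steps. -/

theorem theorem4p2 {n : ℕ} (hn : n = 1 ∨ n = 2) (D : TwoPhaseFEM.FlowData n)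
    (S : TwoPhaseFEM.Discretization D) (Γ : ℕ → TwoPhaseFEM.Interface n)
    (U : ℕ → TwoPhaseFEM.Pt n → TwoPhaseFEM.Pt n) (P : ℕ → TwoPhaseFEM.Pt n → ℝ)
    (X : ℕ → TwoPhaseFEM.Pt n → TwoPhaseFEM.Pt n) (κ : ℕ → TwoPhaseFEM.Pt n → ℝ)
    (hU₀ : (S.mesh 0).IsPiecewisePoly 2 (U 0))
    (hsol : S.IsSolution Γ U P X κ)
    (hA : ∀ m < S.M, (Γ m).Admissible D.Ω)
    (hinterp : ∀ m, 1 ≤ m → m < S.M →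
      TwoPhaseFEM.wInner D.Ω (S.ρLag Γ m) ((S.mesh m).I2 (U m)) ((S.mesh m).I2 (U m)) ≤
        TwoPhaseFEM.wInner D.Ω (S.ρPrev Γ m) (U m) (U m)) :
    ∀ m < S.M,
      D.energy (S.ρ Γ m) (U (m + 1)) (X (m + 1) '' (Γ m).carrier) +
          1 / 2 * ∑ k ∈ Finset.range (m + 1),
            (TwoPhaseFEM.wInner D.Ω (S.ρLag Γ k)
                (fun x => U (k + 1) x - (S.mesh k).I2 (U k) x)
                (fun x => U (k + 1) x - (S.mesh k).I2 (U k) x) +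
              4 * S.τ k * TwoPhaseFEM.viscInner D.Ω (S.μ Γ k) (U (k + 1)) (U (k + 1)) +
              2 * D.β * S.τ k *
                TwoPhaseFEM.tangInner D.Ω D.slip (U (k + 1)) (U (k + 1))) ≤
        D.energy (S.ρPrev Γ 0) (U 0) (Γ 0).carrier +
          ∑ k ∈ Finset.range (m + 1),
            S.τ k * ∫ x in D.Ω, inner ℝ (S.load Γ k x) (U (k + 1) x) := by
  intro m
  induction m with
  | zero =>
    intro hm
    have h := hsol.energy_step hn hm
    simp only [TwoPhaseFEM.FlowData.energy,
      TwoPhaseFEM.Discretization.wInner_ρLag_zero hU₀] at h ⊢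
    simpa only [zero_add, Finset.sum_range_one] using h
  | succ m ih =>
    intro hm
    have h := hsol.energy_step hn hm
    have hprev := ih (by omega)
    have hkin := hinterp (m + 1) (by omega) hm
    rw [Finset.sum_range_succ _ (m + 1), Finset.sum_range_succ _ (m + 1)]
    -- The image X^{m+1}(Γ^m) is the next triangulated surface only while m + 1 < M, which is why
    -- the final energy is stated with the image.
    rw [← hsol.next_surface m hm] at hprev
    simp only [TwoPhaseFEM.FlowData.energy, TwoPhaseFEM.Discretization.ρPrev] at h hprev hkin ⊢
    linarith
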